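/- Let $\mathcal O(\mathbb N^{\mathbb N})$ and $\mathcal A(\mathbb N^{\mathbb N})$ be the represented spaces of open and of closed subsets of Baire space: a name of an open set $U$ is a name of its characteristic function as a continuous function from $\mathbb N^{\mathbb N}$ into Sierpiński space, and the names of a closed set $A$ are those of the open set $\mathbb N^{\mathbb N}\setminus A$. In the Gale–Stewart game with winning condition $W\subseteq\mathbb N^{\mathbb N}$, Players 1 and 2 alternately choose natural numbers $x_0,x_1,x_2,\dots$, Player 1 moving first; Player 1 wins if $(x_n)_n\in W$, and Player 2 wins otherwise. Strategies, that is, functions from finite sequences of natural numbers to $\mathbb N$, are coded as elements of $\mathbb N^{\mathbb N}$. Let $\mathsf{FindWS}_{\boldsymbol\Pi}:\subseteq\mathcal O(\mathbb N^{\mathbb N})\rightrightarrows\mathbb N^{\mathbb N}$ be the multivalued function whose domain consists of the open sets $W$ for which Player 1 has no winning strategy, and which maps such a $W$ to any winning strategy of Player 2. Let $\mathsf C_{\mathbb N^{\mathbb N}}:\subseteq\mathcal A(\mathbb N^{\mathbb N})\rightrightarrows\mathbb N^{\mathbb N}$ be the multivalued function that maps a nonempty closed set $A$ to any element of $A$.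 Then $\mathsf{FindWS}_{\boldsymbol\Pi}\equiv_{\mathrm W}\mathsf C_{\mathbb N^{\mathbb N}}$, where $f\le_{\mathrm W}g$ means that there are computable $K,H:\subseteq\mathbb N^{\mathbb N}\to\mathbb N^{\mathbb N}$ such that $p\mapsto K\langle p,G(H(p))\rangle$ realizes $f$ for every realizer $G$ of $g$, and $f\equiv_{\mathrm W}g$ means $f\le_{\mathrm W}g$ and $g\le_{\mathrm W}f$. -/

import Mathlib

/-- Baire space `ℕ^ℕ`. -/
abbrev Baire : Type := ℕ → ℕ

/-- The finite initial segment `(x 0, …, x (n - 1))`. -/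
def initSeg (x : Baire) (n : ℕ) : List ℕ := (List.range n).map x

/-- The pairing `⟨p, q⟩` on Baire space: `p` on the even and `q` on the odd positions. -/
def bairePair (p q : Baire) : Baire := fun n => if n % 2 = 0 then p (n / 2) else q (n / 2)

/-! ### Computable partial functions on Baire space -/

/-- Partial recursive functionals with one function oracle: `Φ p n` is the outcome of one fixed
program on the input `n` with the oracle `p`. -/
inductive OracleRecursive : (Baire → ℕ →. ℕ) → Prop
  | zero : OracleRecursive fun _ _ => Part.some 0
  | succ : OracleRecursive fun _ n => Part.some (n + 1)
  | left : OracleRecursive fun _ n => Part.some (Nat.unpair n).1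
  | right : OracleRecursive fun _ n => Part.some (Nat.unpair n).2
  | oracle : OracleRecursive fun p n => Part.some (p n)
  | pair {Φ Ψ : Baire → ℕ →. ℕ} (hΦ : OracleRecursive Φ) (hΨ : OracleRecursive Ψ) :
      OracleRecursive fun p n => (Φ p n).bind fun a => (Ψ p n).map fun b => Nat.pair a b
  | comp {Φ Ψ : Baire → ℕ →. ℕ} (hΦ : OracleRecursive Φ) (hΨ : OracleRecursive Ψ) :
      OracleRecursive fun p n => (Ψ p n).bind (Φ p)
  | prec {Φ Ψ : Baire → ℕ →. ℕ} (hΦ : OracleRecursive Φ) (hΨ : OracleRecursive Ψ) :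
      OracleRecursive fun p n =>
        Nat.rec (motive := fun _ => Part ℕ) (Φ p (Nat.unpair n).1)
          (fun y ih => ih.bind fun i => Ψ p (Nat.pair (Nat.unpair n).1 (Nat.pair y i)))
          (Nat.unpair n).2
  | rfind {Φ : Baire → ℕ →. ℕ} (hΦ : OracleRecursive Φ) :
      OracleRecursive fun p n =>
        Nat.rfind fun m => (Φ p (Nat.pair n m)).map fun k => decide (k = 0)

/-- A partial function on Baire space is computable if one program with oracle `p` computes
`F p`, for all `p` in the domain of `F`. -/
def BaireComputable (F : Baire →. Baire) : Prop :=
  ∃ Φ : Baire → ℕ →. ℕ, OracleRecursive Φ ∧ ∀ p, ∀ q ∈ F p, ∀ n, q n ∈ Φ p n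

/-- A partial function on Baire space is continuous if it is so on its domain. -/
def BaireContinuous (F : Baire →. Baire) : Prop :=
  Continuous fun p : F.Dom => F.fn p.1 p.2

/-! ### Represented spaces -/

/-- A represented space. The partial surjection `δ` from Baire space is given by its graph:
`IsName p x` says that `p` is in the domain of `δ` and `δ p = x`. -/
structure RepSpace where
  carrier : Type
  IsName : Baire → carrier → Prop
  unique : ∀ {p x y}, IsName p x → IsName p y → x = y
  surj : ∀ x, ∃ p, IsName p x

/-- Baire space, represented by the identity. -/
def baireSpace : RepSpace where
  carrier := Baire
  IsName p x := p = x
  unique h h' := h.symm.trans h'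
  surj x := ⟨x, rfl⟩

/-- Sierpinski space: the only name of `⊥` is the zero sequence, all others name `⊤`. -/
def sierpinski : RepSpace where
  carrier := Prop
  IsName p b := b ↔ ∃ n, p n ≠ 0
  unique h h' := propext (h.trans h'.symm)
  surj b := by
    by_cases hb : b
    · exact ⟨fun _ => 1, by simp [hb]⟩
    · exact ⟨fun _ => 0, by simp [hb]⟩

/-- `F` realizes the (single-valued, total) function `f`. -/
def RealizesFun {X Y : RepSpace} (F : Baire →. Baire) (f : X.carrier → Y.carrier) : Prop :=
  ∀ p x, X.IsName p x → ∃ q ∈ F p, Y.IsName q (f x)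

/-- A function between represented spaces is continuous if it has a continuous realizer. -/
def RepContinuous {X Y : RepSpace} (f : X.carrier → Y.carrier) : Prop :=
  ∃ F : Baire →. Baire, BaireContinuous F ∧ RealizesFun F f

/-- The continuous partial function on Baire space coded by `α` (Kleene's second algebra): the
`n`-th value at `x` is `k` if the first nonzero term among `α ⟨n, (x 0, …, x (m - 1))⟩`,
`m = 0, 1, 2, …`, is `k + 1`. The value at `x` is defined if all its terms are. -/
def kleeneApp (α : Baire) : Baire →. Baire := fun x =>
  { Dom := ∀ n, ∃ m, α (Nat.pair n (Encodable.encode (initSeg x m))) ≠ 0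
    get := fun h n => α (Nat.pair n (Encodable.encode (initSeg x (Nat.find (h n))))) - 1 }

theorem initSeg_length (x : Baire) (n : ℕ) : (initSeg x n).length = n := by simp [initSeg]

theorem initSeg_eq_iff {x y : Baire} {n : ℕ} :
    initSeg x n = initSeg y n ↔ ∀ i < n, x i = y i := by
  simp [initSeg]

theorem initSeg_succ (x : Baire) (n : ℕ) : initSeg x (n + 1) = initSeg x n ++ [x n] := by
  simp [initSeg, List.range_succ]

/-- A neighbourhood of a point of Baire space contains a cylinder around that point. -/
theorem exists_cylinder {U : Set Baire} {x : Baire} (h : U ∈ nhds x) :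
    ∃ m, ∀ y, initSeg y m = initSeg x m → y ∈ U := by
  rw [nhds_pi, Filter.mem_pi] at h
  obtain ⟨I, hI, t, ht, hU⟩ := h
  obtain ⟨b, hb⟩ := hI.bddAbove
  refine ⟨b + 1, fun y hy => hU fun i hi => ?_⟩
  rw [initSeg_eq_iff.1 hy i (Nat.lt_succ_of_le (hb hi))]
  exact mem_of_mem_nhds (ht i)

/-- Every continuous partial function on Baire space is extended by one that has a code. -/
theorem exists_kleeneApp {F : Baire →. Baire} (hF : BaireContinuous F) :
    ∃ α, ∀ x, ∀ q ∈ F x, q ∈ kleeneApp α x := by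
  classical
  let good : ℕ → List ℕ → ℕ → Prop := fun n w k =>
    (∃ x q, q ∈ F x ∧ initSeg x w.length = w) ∧
      ∀ x q, q ∈ F x → initSeg x w.length = w → q n = k
  let α : Baire := fun c =>
    if h : ∃ k, good c.unpair.1 ((Encodable.decode (α := List ℕ) c.unpair.2).getD []) k
    then h.choose + 1 else 0
  have hα : ∀ n w k, α (Nat.pair n (Encodable.encode w)) = k + 1 → good n w k := by
    intro n w k h
    simp only [α] at h
    split_ifs at h with h'
    have h1 := h'.choose_spec
    have h2 : h'.choose = k := by omega
    rw [h2] at h1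
    simpa only [Nat.unpair_pair, Encodable.encodek, Option.getD_some] using h1
  have hα' : ∀ n w k, good n w k → α (Nat.pair n (Encodable.encode w)) ≠ 0 := by
    intro n w k h
    simp only [α]
    rw [dif_pos]
    · exact Nat.succ_ne_zero _
    · refine ⟨k, ?_⟩
      simpa only [Nat.unpair_pair, Encodable.encodek, Option.getD_some] using h
  refine ⟨α, fun x q hq => ?_⟩
  have hdom : ∀ n, ∃ m, α (Nat.pair n (Encodable.encode (initSeg x m))) ≠ 0 := by
    intro n
    have hx : x ∈ F.Dom := Part.dom_iff_mem.2 ⟨q, hq⟩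
    have hc : Continuous fun p : F.Dom => F.fn p.1 p.2 n := (continuous_apply n).comp hF
    have hn := hc.continuousAt.preimage_mem_nhds
      ((isOpen_discrete ({F.fn x hx n} : Set ℕ)).mem_nhds (x := F.fn x hx n) rfl)
      (x := ⟨x, hx⟩)
    rw [mem_nhds_subtype] at hn
    obtain ⟨U, hU, hUs⟩ := hn
    obtain ⟨m, hm⟩ := exists_cylinder hU
    refine ⟨m, hα' n _ (q n) ⟨⟨x, q, hq, by rw [initSeg_length]⟩, fun y r hr hy => ?_⟩⟩
    rw [initSeg_length] at hy
    have hyd : y ∈ F.Dom := Part.dom_iff_mem.2 ⟨r, hr⟩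
    have h1 : F.fn y hyd n = F.fn x hx n := hUs (a := ⟨y, hyd⟩) (hm y hy)
    have h2 : F.fn y hyd = r := Part.get_eq_of_mem hr hyd
    have h3 : F.fn x hx = q := Part.get_eq_of_mem hq hx
    rw [← h2, ← h3, h1]
  refine ⟨hdom, ?_⟩
  funext n
  have hs := Nat.find_spec (hdom n)
  obtain ⟨k, hk⟩ := Nat.exists_eq_succ_of_ne_zero hs
  have hg := (hα n _ k hk).2 x q hq (by rw [initSeg_length])
  change α _ - 1 = q n
  rw [hk, hg]
  rfl

/-- The space of continuous functions from `X` to `Y`: a name of `f` is a code of a realizer. -/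
def funSpace (X Y : RepSpace) : RepSpace where
  carrier := {f : X.carrier → Y.carrier // RepContinuous f}
  IsName α f := RealizesFun (kleeneApp α) f.1
  unique := by
    intro α f g hf hg
    apply Subtype.ext
    funext x
    obtain ⟨p, hp⟩ := X.surj x
    obtain ⟨q, hq, hqf⟩ := hf p x hp
    obtain ⟨r, hr, hrg⟩ := hg p x hp
    rw [Part.mem_unique hq hr] at hqf
    exact Y.unique hqf hrg
  surj := by
    rintro ⟨f, F, hF, hFf⟩
    obtain ⟨α, hα⟩ := exists_kleeneApp hF
    refine ⟨α, fun p x hp => ?_⟩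
    obtain ⟨q, hq, hqf⟩ := hFf p x hp
    exact ⟨q, hα p q hq, hqf⟩

/-- The space `𝒪(X)` of open subsets of `X`: a set is identified with its continuous
characteristic function into Sierpinski space. -/
def openSpace (X : RepSpace) : RepSpace := funSpace X sierpinski

/-- The set of points of an element of `𝒪(X)`. -/
def openSpace.toSet {X : RepSpace} (U : (openSpace X).carrier) : Set X.carrier := {x | U.1 x}

/-- The space `𝒜(X)` of closed subsets of `X`: the names of `A` are those of its complement
in `𝒪(X)`. -/
def closedSpace (X : RepSpace) : RepSpace where
  carrier := {A : Set X.carrier //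
    RepContinuous (X := X) (Y := sierpinski) fun x => x ∉ A}
  IsName p A := (openSpace X).IsName p ⟨fun x => x ∉ A.1, A.2⟩
  unique := by
    intro p A B hA hB
    have h := congrArg Subtype.val ((openSpace X).unique hA hB)
    apply Subtype.ext
    ext x
    exact not_iff_not.1 (iff_of_eq (congrFun h x))
  surj A := (openSpace X).surj _

/-! ### Multivalued functions and Weihrauch reducibility -/

/-- A partial multivalued function from `X` to `Y`. -/
structure MultiFun (X Y : RepSpace) where
  dom : Set X.carrier
  val : X.carrier → Set Y.carrier
  nonempty : ∀ x ∈ dom, (val x).Nonempty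

/-- `F` realizes the partial multivalued function `f`. -/
def Realizes {X Y : RepSpace} (F : Baire →. Baire) (f : MultiFun X Y) : Prop :=
  ∀ p x, X.IsName p x → x ∈ f.dom → ∃ q ∈ F p, ∃ y ∈ f.val x, Y.IsName q y

/-- Weihrauch reducibility: there are computable `K`, `H` such that `p ↦ K ⟨p, G (H p)⟩` realizes
`f` for every realizer `G` of `g`. -/
def WeihrauchLE {X Y Z W : RepSpace} (f : MultiFun X Y) (g : MultiFun Z W) : Prop :=
  ∃ K H : Baire →. Baire, BaireComputable K ∧ BaireComputable H ∧
    ∀ G : Baire →. Baire, Realizes G g →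
      Realizes (fun p => (H p).bind fun a => (G a).bind fun b => K (bairePair p b)) f

/-- Weihrauch equivalence. -/
def WeihrauchEquiv {X Y Z W : RepSpace} (f : MultiFun X Y) (g : MultiFun Z W) : Prop :=
  WeihrauchLE f g ∧ WeihrauchLE g f

/-- Closed choice on `X`: given a nonempty closed set, find one of its points. -/
def closedChoice (X : RepSpace) : MultiFun (closedSpace X) X where
  dom := {A | A.1.Nonempty}
  val A := A.1
  nonempty _ h := h

/-! ### Gale-Stewart games

The players alternately choose natural numbers, Player 1 choosing `x 0, x 2, …` and Player 2
choosing `x 1, x 3, …`. Player 1 wins the play `x` if `x ∈ W`, otherwise Player 2 wins. A strategy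
is a point of Baire space: its value at the code of a position is the move to make there. -/

/-- Player 1 follows the strategy `σ` in the play `x`. -/
def Follows1 (σ x : Baire) : Prop :=
  ∀ n, x (2 * n) = σ (Encodable.encode (initSeg x (2 * n)))

/-- Player 2 follows the strategy `τ` in the play `x`. -/
def Follows2 (τ x : Baire) : Prop :=
  ∀ n, x (2 * n + 1) = τ (Encodable.encode (initSeg x (2 * n + 1)))

/-- `σ` is a winning strategy for Player 1 in the game `W`. -/
def Wins1 (W : Set Baire) (σ : Baire) : Prop := ∀ x, Follows1 σ x → x ∈ W

/-- `τ` is a winning strategy for Player 2 in the game `W`. -/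
def Wins2 (W : Set Baire) (τ : Baire) : Prop := ∀ x, Follows2 τ x → x ∉ W

theorem isOpen_toSet (U : (openSpace baireSpace).carrier) :
    IsOpen (show Set Baire from openSpace.toSet U) := by
  obtain ⟨f, F, hF, hFf⟩ := U
  have hd : ∀ x, x ∈ F.Dom := fun x => by
    obtain ⟨q, hq, -⟩ := hFf x x rfl
    exact Part.dom_iff_mem.2 ⟨q, hq⟩
  have hc : Continuous fun x : Baire => F.fn x (hd x) :=
    hF.comp (continuous_id.subtype_mk hd)
  have ho : IsOpen {q : Baire | ∃ n, q n ≠ 0} := by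
    have : {q : Baire | ∃ n, q n ≠ 0} = ⋃ n, (fun q : Baire => q n) ⁻¹' {k : ℕ | k ≠ 0} := by
      ext q
      simp
    rw [this]
    exact isOpen_iUnion fun n => (isOpen_discrete _).preimage (continuous_apply n)
  have he : (show Set Baire from openSpace.toSet ⟨f, F, hF, hFf⟩) =
      (fun x : Baire => F.fn x (hd x)) ⁻¹' {q : Baire | ∃ n, q n ≠ 0} := by
    ext x
    obtain ⟨q, hq, hqf⟩ := hFf x x rfl
    have h2 : F.fn x (hd x) = q := Part.get_eq_of_mem hq (hd x)
    change f x ↔ ∃ n, F.fn x (hd x) n ≠ 0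
    rw [h2]
    exact hqf
  rw [he]
  exact ho.preimage hc

/-- Open games are determined. -/
theorem open_determinacy {W : Set Baire} (hW : IsOpen W) (h1 : ¬ ∃ σ, Wins1 W σ) :
    ∃ τ, Wins2 W τ := by
  classical
  -- `Q u`: Player 1 has a strategy that wins from the position `u` on.
  let Q : List ℕ → Prop := fun u => ∃ σ : Baire, ∀ x : Baire, initSeg x u.length = u →
    (∀ n, u.length ≤ 2 * n → x (2 * n) = σ (Encodable.encode (initSeg x (2 * n)))) → x ∈ W
  have hQ0 : ¬ Q [] := by
    rintro ⟨σ, hσ⟩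
    exact h1 ⟨σ, fun x hx => hσ x rfl fun n _ => hx n⟩
  have hQeven : ∀ (u : List ℕ) (a : ℕ), u.length % 2 = 0 → Q (u ++ [a]) → Q u := by
    rintro u a hu ⟨σ, hσ⟩
    refine ⟨Function.update σ (Encodable.encode u) a, fun x hxu hx => ?_⟩
    have ha : x u.length = a := by
      have h2 : 2 * (u.length / 2) = u.length := by omega
      have := hx (u.length / 2) (by omega)
      rw [h2, hxu] at this
      simpa using this
    refine hσ x (by simp [initSeg_succ, hxu, ha]) fun n hn => ?_
    rw [List.length_append, List.length_singleton] at hn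
    rw [hx n (by omega), Function.update_of_ne]
    intro he
    have := congrArg List.length (Encodable.encode_injective he)
    rw [initSeg_length] at this
    omega
  have hQodd : ∀ u : List ℕ, u.length % 2 = 1 → (∀ a, Q (u ++ [a])) → Q u := by
    intro u hu h
    choose σ hσ using h
    refine ⟨fun c => σ (((Encodable.decode (α := List ℕ) c).getD []).getD u.length 0) c,
      fun x hxu hx => ?_⟩
    refine hσ (x u.length) x (by simp [initSeg_succ, hxu]) fun n hn => ?_
    rw [List.length_append, List.length_singleton] at hn
    rw [hx n (by omega)]
    have hlt : u.length < 2 * n := by omega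
    simp [initSeg, hlt]
  refine ⟨fun c => if h : ∃ a, ¬ Q ((Encodable.decode (α := List ℕ) c).getD [] ++ [a])
    then h.choose else 0, fun x hx hxW => ?_⟩
  have hn : ∀ n, ¬ Q (initSeg x n) := by
    intro n
    induction n with
    | zero => exact hQ0
    | succ n ih =>
      rw [initSeg_succ]
      rcases Nat.mod_two_eq_zero_or_one n with h0 | h0
      · exact fun h => ih (hQeven _ _ (by rw [initSeg_length]; exact h0) h)
      · have hex : ∃ a, ¬ Q (initSeg x n ++ [a]) := by
          by_contra! hcon
          exact ih (hQodd _ (by rw [initSeg_length]; exact h0) hcon)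
        have h2 : 2 * (n / 2) + 1 = n := by omega
        have hm := hx (n / 2)
        rw [h2] at hm
        simp only [Encodable.encodek, Option.getD_some] at hm
        rw [dif_pos hex] at hm
        rw [hm]
        exact hex.choose_spec
  obtain ⟨m, hm⟩ := exists_cylinder (hW.mem_nhds hxW)
  exact hn m ⟨x, fun y hy _ => hm y (by rwa [initSeg_length] at hy)⟩

/-- Given an open game in which Player 1 has no winning strategy, find a winning strategy for
Player 2. -/
def FindWSPi : MultiFun (openSpace baireSpace) baireSpace where
  dom := {W | ¬ ∃ σ, Wins1 (openSpace.toSet W) σ}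
  val W := {τ | Wins2 (openSpace.toSet W) τ}
  nonempty W h := open_determinacy (isOpen_toSet W) h

/-! A name of an open set `U` enumerates cylinders with union `U`. If `S` is a set-valued map for
which an initial segment of `x` decides whether `S x` meets a given cylinder, then waiting for an
enumerated cylinder that meets `S x` turns names of `U` into names of `{x | (S x ∩ U).Nonempty}`.
Applied to `S τ = {x | Follows2 τ x}`, this enumerates the strategies of Player 2 that do not win,
so the winning ones form a closed set, from which closed choice selects a point. Applied to
`S x = {oddPart x}`, it yields the game in which Player 2 has to produce a point of a given closed
set `A` and the moves of Player 1 are ignored; the answers of a winning strategy to the moves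
`0, 0, 0, …` are a point of `A`. Neither reduction uses its original input a second time. -/

/-! ### Oracle computations -/

/-- A total function is computable with an oracle if its graph, read through the codes of its
arguments and values, is the outcome of one program; natural numbers are their own codes. -/
def OracleComputable {α β : Type*} [Denumerable α] [Denumerable β] (f : Baire → α → β) : Prop :=
  OracleRecursive fun p n => Part.some (Encodable.encode (f p (Denumerable.ofNat α n)))

namespace OracleComputable

variable {α β γ : Type*} [Denumerable α] [Denumerable β] [Denumerable γ]

theorem oracle : OracleComputable fun (p : Baire) (n : ℕ) => p n :=
  OracleRecursive.oracle

theorem comp {f : Baire → β → γ} {g : Baire → α → β} (hf : OracleComputable f)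
    (hg : OracleComputable g) : OracleComputable fun p a => f p (g p a) := by
  simpa only [OracleComputable, Part.bind_some, Denumerable.ofNat_encode] using
    OracleRecursive.comp hf hg

theorem pair {f : Baire → α → β} {g : Baire → α → γ} (hf : OracleComputable f)
    (hg : OracleComputable g) : OracleComputable fun p a => (f p a, g p a) := by
  simpa only [OracleComputable, Encodable.encode_prod_val, Part.bind_some, Part.map_some] using
    OracleRecursive.pair hf hg

theorem natRec {f g : Baire → ℕ → ℕ} (hf : OracleComputable f) (hg : OracleComputable g) :
    OracleComputable fun (p : Baire) (n : ℕ) => (Nat.rec (f p n.unpair.1)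
      (fun m r => g p (Nat.pair n.unpair.1 (Nat.pair m r))) n.unpair.2 : ℕ) := by
  refine (congrArg OracleRecursive (funext₂ fun p n => ?_)).mp (OracleRecursive.prec hf hg)
  simp only [Denumerable.ofNat_nat, Encodable.encode_nat]
  induction n.unpair.2 with
  | zero => rfl
  | succ m ih => simp only [ih, Part.bind_some]

theorem of_natPrimrec {f : ℕ → ℕ} (hf : Nat.Primrec f) : OracleComputable fun _ => f := by
  induction hf with
  | zero => exact OracleRecursive.zero
  | succ => exact OracleRecursive.succ
  | left => exact OracleRecursive.left
  | right => exact OracleRecursive.right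
  | pair _ _ hf hg => exact hf.pair hg
  | comp _ _ hf hg => exact hf.comp hg
  | prec _ _ hf hg => exact hf.natRec hg

theorem of_primrec {f : α → β} (hf : Primrec f) : OracleComputable fun _ => f :=
  of_natPrimrec (Primrec.nat_iff.1 (Primrec.encode.comp (hf.comp (Primrec.ofNat α))))

theorem iterate {f : Baire → α → α} (hf : OracleComputable f) (a : α) :
    OracleComputable fun p n => (f p)^[n] a := by
  let g (p : Baire) (c : ℕ) : ℕ :=
    Encodable.encode (f p (Denumerable.ofNat α c.unpair.2.unpair.2))
  have hlast : Primrec fun c : ℕ => Denumerable.ofNat α c.unpair.2.unpair.2 :=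
    (Primrec.ofNat α).comp
      (Primrec.snd.comp (Primrec.unpair.comp (Primrec.snd.comp Primrec.unpair)))
  have hg : OracleComputable g := (of_primrec Primrec.encode).comp (hf.comp (of_primrec hlast))
  have hstart : Primrec fun n : ℕ => Nat.pair 0 n :=
    Primrec₂.natPair.comp (Primrec.const 0) Primrec.id
  have hrec := ((of_primrec (Primrec.const (Encodable.encode a))).natRec hg).comp
    (of_primrec hstart)
  refine (congrArg OracleRecursive (funext₂ fun p n => ?_)).mp hrec
  simp only [Nat.unpair_pair, Denumerable.ofNat_nat, Encodable.encode_nat, Part.some_inj, g]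
  induction n with
  | zero => rfl
  | succ n ih => simp only [ih, Denumerable.ofNat_encode, Function.iterate_succ_apply']

end OracleComputable

theorem OracleRecursive.comp_oracle {Φ : Baire → ℕ →. ℕ} (hΦ : OracleRecursive Φ)
    {f : Baire → Baire} (hf : OracleComputable f) : OracleRecursive fun p => Φ (f p) := by
  induction hΦ with
  | zero => exact .zero
  | succ => exact .succ
  | left => exact .left
  | right => exact .right
  | oracle => exact hf
  | pair _ _ hΦ hΨ => exact .pair hΦ hΨ
  | comp _ _ hΦ hΨ => exact .comp hΦ hΨ
  | prec _ _ hΦ hΨ => exact .prec hΦ hΨ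
  | rfind _ hΦ => exact .rfind hΦ

theorem OracleComputable.baireComputable {f : Baire → Baire} (hf : OracleComputable f) :
    BaireComputable fun p => Part.some (f p) :=
  ⟨_, hf, fun _ _ hq n => Part.mem_some_iff.2 (congrFun (Part.mem_some_iff.1 hq) n)⟩

theorem BaireComputable.comp {F : Baire →. Baire} (hF : BaireComputable F) {f : Baire → Baire}
    (hf : OracleComputable f) : BaireComputable fun p => F (f p) := by
  obtain ⟨Φ, hΦ, hΦF⟩ := hF
  exact ⟨fun p => Φ (f p), hΦ.comp_oracle hf, fun p => hΦF (f p)⟩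

/-! ### Finite sequences -/

/-- The set of all extensions of `w` to an infinite sequence. -/
def cylinder (w : List ℕ) : Set Baire := {x | initSeg x w.length = w}

/-- The extension of a finite sequence by zeros. It makes notions defined for infinite sequences
available for their initial segments. -/
def zeroExtend (u : List ℕ) : Baire := fun i => u.getD i 0

theorem take_initSeg (x : Baire) {i m : ℕ} (h : i ≤ m) : (initSeg x m).take i = initSeg x i := by
  simp [initSeg, ← List.map_take, List.take_range, min_eq_left h]

theorem zeroExtend_initSeg (x : Baire) {i m : ℕ} (h : i < m) :
    zeroExtend (initSeg x m) i = x i := by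
  simp [zeroExtend, initSeg, h]

theorem initSeg_mem_cylinder (x : Baire) (m : ℕ) : x ∈ cylinder (initSeg x m) := by
  rw [cylinder, Set.mem_ofPred_eq, initSeg_length]

theorem mem_cylinder_iff {x : Baire} {w : List ℕ} :
    x ∈ cylinder w ↔ ∀ i < w.length, x i = zeroExtend w i := by
  rw [cylinder, Set.mem_ofPred_eq, List.ext_getElem_iff]
  simp +contextual [initSeg, zeroExtend]

theorem cylinder_mem_nhds (x : Baire) (m : ℕ) : cylinder (initSeg x m) ∈ nhds x := by
  refine Filter.mem_of_superset
    ((PiNat.isOpen_cylinder _ x m).mem_nhds (PiNat.self_mem_cylinder x m)) fun y hy => ?_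
  rw [cylinder, Set.mem_ofPred_eq, initSeg_length]
  exact initSeg_eq_iff.2 hy

theorem encode_take_le_encode (w : List ℕ) (i : ℕ) :
    Encodable.encode (w.take i) ≤ Encodable.encode w := by
  induction w generalizing i with
  | nil => simp
  | cons a w ih =>
    cases i with
    | zero => simp
    | succ i =>
      rw [List.take_succ_cons, Encodable.encode_list_cons, Encodable.encode_list_cons]
      have hmono : StrictMono (Nat.pair (Encodable.encode a)) :=
        fun _ _ => Nat.pair_lt_pair_right _
      exact Nat.succ_le_succ (hmono.monotone (ih i))

theorem primrec_zeroExtend : Primrec₂ zeroExtend := Primrec.list_getD 0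

/-- The sequence in which each term is the value of the rule `f` at the terms before it. -/
def play (f : List ℕ → ℕ) : Baire := fun n => f ((fun u => u ++ [f u])^[n] [])

theorem initSeg_play (f : List ℕ → ℕ) (n : ℕ) :
    initSeg (play f) n = (fun u => u ++ [f u])^[n] [] := by
  induction n with
  | zero => rfl
  | succ n ih => rw [initSeg_succ, Function.iterate_succ_apply', ih, play]

theorem play_apply (f : List ℕ → ℕ) (n : ℕ) : play f n = f (initSeg (play f) n) := by
  rw [initSeg_play, play]

theorem oracleComputable_initSeg_play {f : Baire → List ℕ → ℕ} (hf : OracleComputable f) :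
    OracleComputable fun p => initSeg (play (f p)) := by
  have happend : Primrec fun t : List ℕ × ℕ => t.1 ++ [t.2] := Primrec.list_concat
  have hstep : OracleComputable fun p u => u ++ [f p u] :=
    (OracleComputable.of_primrec happend).comp ((OracleComputable.of_primrec Primrec.id).pair hf)
  exact (funext₂ fun p n => (initSeg_play (f p) n).symm) ▸ hstep.iterate []

theorem oracleComputable_play {f : Baire → List ℕ → ℕ} (hf : OracleComputable f) :
    OracleComputable fun p => play (f p) :=
  (funext₂ fun p n => (play_apply (f p) n).symm) ▸ hf.comp (oracleComputable_initSeg_play hf)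

theorem oracleComputable_initSeg : OracleComputable initSeg := by
  have hplay (p : Baire) : play (fun u => p u.length) = p :=
    funext fun n => by rw [play_apply, initSeg_length]
  have hnext : OracleComputable fun (p : Baire) (u : List ℕ) => p u.length :=
    OracleComputable.oracle.comp (.of_primrec Primrec.list_length)
  simpa only [hplay] using oracleComputable_initSeg_play hnext

theorem oracleComputable_of_initSeg {α β : Type*} [Denumerable α] [Denumerable β]
    {g : List ℕ → α → β} {k : α → ℕ} (hg : Primrec₂ g) (hk : Primrec k) :
    OracleComputable fun p a => g (initSeg p (k a)) a := by
  have hg' : Primrec fun t : List ℕ × α => g t.1 t.2 := hg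
  exact (OracleComputable.of_primrec hg').comp
    ((oracleComputable_initSeg.comp (.of_primrec hk)).pair (.of_primrec Primrec.id))

/-! ### Codes of open sets -/

/-- The program coded by `α` (in the sense of `kleeneApp`) outputs `k` as the `n`-th value of every
point of the cylinder of `w`, after reading exactly `w`. -/
def Emits (α : Baire) (n : ℕ) (w : List ℕ) (k : ℕ) : Prop :=
  α (Nat.pair n (Encodable.encode w)) = k + 1 ∧
    ∀ i < w.length, α (Nat.pair n (Encodable.encode (w.take i))) = 0

theorem emits_initSeg_iff {α x : Baire} {n m k : ℕ} :
    Emits α n (initSeg x m) k ↔ α (Nat.pair n (Encodable.encode (initSeg x m))) = k + 1 ∧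
      ∀ i < m, α (Nat.pair n (Encodable.encode (initSeg x i))) = 0 := by
  rw [Emits, initSeg_length]
  exact and_congr_right' (forall₂_congr fun i hi => by rw [take_initSeg x hi.le])

theorem Emits.unique {α x : Baire} {n m m' k k' : ℕ} (h : Emits α n (initSeg x m) k)
    (h' : Emits α n (initSeg x m') k') : k = k' := by
  rw [emits_initSeg_iff] at h h'
  obtain hlt | rfl | hgt := lt_trichotomy m m'
  · exact absurd (h'.2 m hlt) (by omega)
  · omega
  · exact absurd (h.2 m' hgt) (by omega)

theorem exists_emits {α x : Baire} {n : ℕ}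
    (h : ∃ m, α (Nat.pair n (Encodable.encode (initSeg x m))) ≠ 0) :
    Emits α n (initSeg x (Nat.find h))
      (α (Nat.pair n (Encodable.encode (initSeg x (Nat.find h)))) - 1) :=
  emits_initSeg_iff.2
    ⟨(Nat.succ_pred (Nat.find_spec h)).symm, fun _ hi => not_not.1 (Nat.find_min h hi)⟩

theorem mem_kleeneApp_iff {α x q : Baire} :
    q ∈ kleeneApp α x ↔ ∀ n, ∃ m, Emits α n (initSeg x m) (q n) := by
  constructor
  · rintro ⟨h, rfl⟩ n
    exact ⟨_, exists_emits (h n)⟩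
  · intro h
    have hdom (n : ℕ) : ∃ m, α (Nat.pair n (Encodable.encode (initSeg x m))) ≠ 0 :=
      (h n).imp fun m hm => by rw [hm.1]; exact Nat.succ_ne_zero _
    exact ⟨hdom, funext fun n => (exists_emits (hdom n)).unique (h n).choose_spec⟩

theorem baireContinuous_kleeneApp (α : Baire) : BaireContinuous (kleeneApp α) := by
  have hvalue (y : (kleeneApp α).Dom) : (kleeneApp α).fn y.1 y.2 ∈ kleeneApp α y.1 :=
    Part.get_mem y.2
  refine continuous_pi fun n => continuous_iff_continuousAt.2 fun x => ?_
  obtain ⟨m, hx⟩ := mem_kleeneApp_iff.1 (hvalue x) n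
  refine tendsto_const_nhds.congr' ?_
  filter_upwards [continuous_subtype_val.continuousAt.preimage_mem_nhds
    (cylinder_mem_nhds x.1 m)] with y hy
  obtain ⟨m', hy'⟩ := mem_kleeneApp_iff.1 (hvalue y) n
  have hseg : initSeg y.1 m = initSeg x.1 m := by
    simpa only [cylinder, Set.mem_preimage, Set.mem_ofPred_eq, initSeg_length] using hy
  exact (hseg ▸ hx).unique hy'

/-- `α` is a name of the open set `U` in `𝒪(ℕ^ℕ)`, and of the closed set `Uᶜ` in `𝒜(ℕ^ℕ)`. -/
def IsOpenCode (α : Baire) (U : Set Baire) : Prop :=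
  RealizesFun (X := baireSpace) (Y := sierpinski) (kleeneApp α) fun x => x ∈ U

theorem isOpenCode_iff {α : Baire} {U : Set Baire} :
    IsOpenCode α U ↔ ∀ x, ∃ q ∈ kleeneApp α x, (x ∈ U ↔ ∃ n, q n ≠ 0) :=
  ⟨fun h x => h x x rfl, fun h _ x hx => hx ▸ h x⟩

namespace IsOpenCode

variable {α : Baire} {U : Set Baire}

theorem repContinuous (h : IsOpenCode α U) :
    RepContinuous (X := baireSpace) (Y := sierpinski) fun x => x ∈ U :=
  ⟨kleeneApp α, baireContinuous_kleeneApp α, h⟩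

theorem exists_openSpace (h : IsOpenCode α U) :
    ∃ V, (openSpace baireSpace).IsName α V ∧ openSpace.toSet V = U :=
  ⟨⟨fun x => x ∈ U, h.repContinuous⟩, h, rfl⟩

theorem exists_closedSpace (h : IsOpenCode α Uᶜ) :
    ∃ A, (closedSpace baireSpace).IsName α A ∧ A.1 = U :=
  ⟨⟨U, h.repContinuous⟩, h, rfl⟩

theorem mem_iff (h : IsOpenCode α U) {x : Baire} :
    x ∈ U ↔ ∃ n w k, Emits α n w (k + 1) ∧ x ∈ cylinder w := by
  obtain ⟨q, hq, hx⟩ := isOpenCode_iff.1 h x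
  rw [mem_kleeneApp_iff] at hq
  rw [hx]
  constructor
  · rintro ⟨n, hn⟩
    obtain ⟨m, hm⟩ := hq n
    obtain ⟨k, hk⟩ := Nat.exists_eq_succ_of_ne_zero hn
    exact ⟨n, _, k, by rwa [hk] at hm, initSeg_mem_cylinder x m⟩
  · rintro ⟨n, w, k, hw, hxw⟩
    obtain ⟨m, hm⟩ := hq n
    have hseg : initSeg x w.length = w := hxw
    have hqn : q n = k + 1 := hm.unique (hseg.symm ▸ hw)
    exact ⟨n, by omega⟩

theorem inter_nonempty_iff (h : IsOpenCode α U) {S : Set Baire} :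
    (S ∩ U).Nonempty ↔ ∃ n w k, Emits α n w (k + 1) ∧ (S ∩ cylinder w).Nonempty := by
  simp only [Set.Nonempty, Set.mem_inter_iff, h.mem_iff]
  grind

end IsOpenCode

section Decision

variable {ι : Type*} [Denumerable ι]

open Classical in
/-- A code of the open set `⋃ i, {x | P i (initSeg x (b i))}`: its `i`-th value tells whether
`P i` holds of the initial segment of length `b i`. -/
noncomputable def decisionCode (b : ι → ℕ) (P : ι → List ℕ → Prop) : Baire := fun c =>
  let t := Denumerable.ofNat (ι × List ℕ) c
  if t.2.length = b t.1 then if P t.1 t.2 then 2 else 1 else 0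

open Classical in
theorem decisionCode_apply (b : ι → ℕ) (P : ι → List ℕ → Prop) (n m : ℕ) (x : Baire) :
    decisionCode b P (Nat.pair n (Encodable.encode (initSeg x m))) =
      if m = b (Denumerable.ofNat ι n) then
        if P (Denumerable.ofNat ι n) (initSeg x m) then 2 else 1
      else 0 := by
  simp only [decisionCode, Denumerable.prod_ofNat_val, Nat.unpair_pair, Denumerable.ofNat_encode,
    initSeg_length]

open Classical in
theorem isOpenCode_decisionCode (b : ι → ℕ) (P : ι → List ℕ → Prop) :
    IsOpenCode (decisionCode b P) {x | ∃ i, P i (initSeg x (b i))} := by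
  refine isOpenCode_iff.2 fun x => ⟨fun n => if P (Denumerable.ofNat ι n)
    (initSeg x (b (Denumerable.ofNat ι n))) then 1 else 0, ?_, ?_⟩
  · refine mem_kleeneApp_iff.2 fun n => ⟨b (Denumerable.ofNat ι n), emits_initSeg_iff.2 ⟨?_, ?_⟩⟩
    · rw [decisionCode_apply, if_pos rfl]
      split_ifs <;> rfl
    · intro i hi
      rw [decisionCode_apply, if_neg hi.ne]
  · have hsurj : Function.Surjective (Denumerable.ofNat ι) :=
      fun i => ⟨Encodable.encode i, Denumerable.ofNat_encode i⟩
    simp [hsurj.exists]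

theorem oracleComputable_decisionCode {a b : ι → ℕ} {P : List ℕ → ι → List ℕ → Prop}
    (ha : Primrec a) (hb : Primrec b)
    (hP : PrimrecPred fun t : List ℕ × ι × List ℕ => P t.1 t.2.1 t.2.2) :
    OracleComputable fun p => decisionCode b fun i => P (initSeg p (a i)) i := by
  classical
  have hlength : PrimrecPred fun t : List ℕ × ι × List ℕ => t.2.2.length = b t.2.1 :=
    Primrec.eq.comp (Primrec.list_length.comp (Primrec.snd.comp .snd)) (hb.comp (.comp .fst .snd))
  have hvalue : Primrec₂ fun (u : List ℕ) (t : ι × List ℕ) =>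
      if t.2.length = b t.1 then if P u t.1 t.2 then 2 else 1 else 0 :=
    Primrec.ite hlength (Primrec.ite hP (.const 2) (.const 1)) (.const 0)
  exact (oracleComputable_of_initSeg hvalue (ha.comp .fst)).comp
    (.of_primrec (Primrec.ofNat (ι × List ℕ)))

end Decision

/-! ### Preimages of open sets under set-valued maps -/

theorem emits_zeroExtend_iff (α : Baire) {m n k : ℕ} {w : List ℕ}
    (hm : Nat.pair n (Encodable.encode w) < m) :
    Emits (zeroExtend (initSeg α m)) n w k ↔ Emits α n w k := by
  have hmono : StrictMono (Nat.pair n) := fun _ _ => Nat.pair_lt_pair_right n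
  have htake (i : ℕ) : zeroExtend (initSeg α m) (Nat.pair n (Encodable.encode (w.take i))) =
      α (Nat.pair n (Encodable.encode (w.take i))) :=
    zeroExtend_initSeg α ((hmono.monotone (encode_take_le_encode w i)).trans_lt hm)
  simp only [Emits, htake, zeroExtend_initSeg α hm]

theorem primrecPred_forall_lt {α : Type*} [Primcodable α] {R : ℕ → α → Prop} {k : α → ℕ}
    (hR : PrimrecRel R) (hk : Primrec k) : PrimrecPred fun a => ∀ i < k a, R i a :=
  (hR.forall_mem_list.comp (Primrec.list_range.comp hk) Primrec.id).of_eq (by simp)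

theorem primrecPred_emits : PrimrecPred fun t : List ℕ × ℕ × List ℕ × ℕ =>
    Emits (zeroExtend t.1) t.2.1 t.2.2.1 t.2.2.2 := by
  have hn : Primrec fun t : List ℕ × ℕ × List ℕ × ℕ => t.2.1 := .comp .fst .snd
  have hw : Primrec fun t : List ℕ × ℕ × List ℕ × ℕ => t.2.2.1 := .comp .fst (.comp .snd .snd)
  have hk : Primrec fun t : List ℕ × ℕ × List ℕ × ℕ => t.2.2.2 := .comp .snd (.comp .snd .snd)
  have hlast : PrimrecPred fun t : List ℕ × ℕ × List ℕ × ℕ =>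
      zeroExtend t.1 (Nat.pair t.2.1 (Encodable.encode t.2.2.1)) = t.2.2.2 + 1 :=
    Primrec.eq.comp (primrec_zeroExtend.comp .fst (Primrec₂.natPair.comp hn
      (Primrec.encode.comp hw))) (Primrec.succ.comp hk)
  have hearlier : PrimrecRel fun (i : ℕ) (t : List ℕ × ℕ × List ℕ × ℕ) =>
      zeroExtend t.1 (Nat.pair t.2.1 (Encodable.encode (t.2.2.1.take i))) = 0 :=
    Primrec.eq.comp (primrec_zeroExtend.comp (Primrec.fst.comp .snd) (Primrec₂.natPair.comp
      (hn.comp .snd) (Primrec.encode.comp (Primrec.list_take.comp .fst (hw.comp .snd)))))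
      (.const 0)
  exact hlast.and (primrecPred_forall_lt hearlier (Primrec.list_length.comp hw))

/-- The set-valued map `S` meets cylinders decidably: whether `S x` has a point in the cylinder of
`w` is a primitive recursive question about `w` and an initial segment of `x` whose length depends
only on `w`. -/
def PrimrecMeets (S : Baire → Set Baire) : Prop :=
  ∃ (b : List ℕ → ℕ) (R : List ℕ → List ℕ → Prop), Primrec b ∧ PrimrecRel R ∧
    ∀ x w, R (initSeg x (b w)) w ↔ (S x ∩ cylinder w).Nonempty

theorem PrimrecMeets.exists_isOpenCode {S : Baire → Set Baire} (hS : PrimrecMeets S) :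
    ∃ H : Baire → Baire, OracleComputable H ∧
      ∀ α U, IsOpenCode α U → IsOpenCode (H α) {x | (S x ∩ U).Nonempty} := by
  obtain ⟨b, R, hb, hR, hmeets⟩ := hS
  let a (i : ℕ × List ℕ × ℕ) : ℕ := Nat.pair i.1 (Encodable.encode i.2.1) + 1
  let P (u : List ℕ) (i : ℕ × List ℕ × ℕ) (v : List ℕ) : Prop :=
    Emits (zeroExtend u) i.1 i.2.1 (i.2.2 + 1) ∧ R v i.2.1
  have ha : Primrec a := Primrec.succ.comp (Primrec₂.natPair.comp .fst
    (Primrec.encode.comp (Primrec.fst.comp .snd)))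
  have hP : PrimrecPred fun t : List ℕ × (ℕ × List ℕ × ℕ) × List ℕ => P t.1 t.2.1 t.2.2 := by
    have hi : Primrec fun t : List ℕ × (ℕ × List ℕ × ℕ) × List ℕ => t.2.1 := .comp .fst .snd
    have hw : Primrec fun t : List ℕ × (ℕ × List ℕ × ℕ) × List ℕ => t.2.1.2.1 :=
      .comp .fst (.comp .snd hi)
    have hk : Primrec fun t : List ℕ × (ℕ × List ℕ × ℕ) × List ℕ => t.2.1.2.2 + 1 :=
      Primrec.succ.comp (.comp .snd (.comp .snd hi))
    exact (primrecPred_emits.comp (Primrec.fst.pair ((Primrec.fst.comp hi).pair (hw.pair hk)))).and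
      (hR.comp (.comp .snd .snd) hw)
  refine ⟨_, oracleComputable_decisionCode ha (hb.comp (.comp .fst .snd)) hP, fun α U hU => ?_⟩
  convert isOpenCode_decisionCode _ _ using 3 with x
  simp only [hU.inter_nonempty_iff, P, a, hmeets, Prod.exists,
    emits_zeroExtend_iff α (Nat.lt_succ_self _)]

/-! ### Strong Weihrauch reducibility -/

/-- Strong Weihrauch reducibility: the outer reduction `K` has access to the value of the realizer
of `g` only, not to the original input. -/
def StrongWeihrauchLE {X Y Z W : RepSpace} (f : MultiFun X Y) (g : MultiFun Z W) : Prop :=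
  ∃ K H : Baire →. Baire, BaireComputable K ∧ BaireComputable H ∧
    ∀ G : Baire →. Baire, Realizes G g →
      Realizes (fun p => (H p).bind fun a => (G a).bind K) f

/-- Strong Weihrauch equivalence. -/
def StrongWeihrauchEquiv {X Y Z W : RepSpace} (f : MultiFun X Y) (g : MultiFun Z W) : Prop :=
  StrongWeihrauchLE f g ∧ StrongWeihrauchLE g f

/-- The subsequence of odd positions: the second component of a pair, and the moves of Player 2 in
a play. -/
def oddPart (x : Baire) : Baire := fun n => x (2 * n + 1)

theorem oddPart_bairePair (p q : Baire) : oddPart (bairePair p q) = q := by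
  funext n
  simp only [oddPart, bairePair]
  rw [if_neg (by omega), show (2 * n + 1) / 2 = n by omega]

theorem primrec_odd : Primrec fun n : ℕ => 2 * n + 1 :=
  Primrec.succ.comp Primrec.nat_double

theorem OracleComputable.oddPart {f : Baire → Baire} (hf : OracleComputable f) :
    OracleComputable fun p => oddPart (f p) :=
  hf.comp (of_primrec primrec_odd)

section Weihrauch

variable {X Y Z W : RepSpace} {f : MultiFun X Y} {g : MultiFun Z W}

theorem StrongWeihrauchLE.weihrauchLE (h : StrongWeihrauchLE f g) : WeihrauchLE f g := by
  obtain ⟨K, H, hK, hH, hreal⟩ := h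
  refine ⟨fun r => K (oddPart r), H, hK.comp OracleComputable.oracle.oddPart, hH, fun G hG => ?_⟩
  simpa only [oddPart_bairePair] using hreal G hG

theorem StrongWeihrauchEquiv.weihrauchEquiv (h : StrongWeihrauchEquiv f g) :
    WeihrauchEquiv f g :=
  ⟨h.1.weihrauchLE, h.2.weihrauchLE⟩

theorem StrongWeihrauchLE.of_oracleComputable {K H : Baire → Baire} (hK : OracleComputable K)
    (hH : OracleComputable H)
    (h : ∀ p x, X.IsName p x → x ∈ f.dom → ∃ z ∈ g.dom, Z.IsName (H p) z ∧
      ∀ q, ∀ w ∈ g.val z, W.IsName q w → ∃ y ∈ f.val x, Y.IsName (K q) y) :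
    StrongWeihrauchLE f g := by
  refine ⟨_, _, hK.baireComputable, hH.baireComputable, fun G hG p x hp hx => ?_⟩
  obtain ⟨z, hz, hHz, hval⟩ := h p x hp hx
  obtain ⟨q, hqG, w, hw, hqw⟩ := hG (H p) z hHz hz
  refine ⟨K q, ?_, hval q w hw hqw⟩
  exact Part.mem_bind (Part.mem_some _) (Part.mem_bind hqG (Part.mem_some _))

end Weihrauch

/-! ### Plays against a strategy -/

/-- The rule by which Player 1 always plays `0` and Player 2 follows the strategy `τ`. -/
def replyRule (τ : Baire) (u : List ℕ) : ℕ :=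
  if u.length % 2 = 1 then τ (Encodable.encode u) else 0

theorem follows2_play_replyRule (τ : Baire) : Follows2 τ (play (replyRule τ)) := by
  intro n
  rw [play_apply, replyRule, initSeg_length, if_pos (by omega)]

theorem oracleComputable_replyRule : OracleComputable replyRule := by
  have hselect : Primrec fun t : List ℕ × ℕ => if t.1.length % 2 = 1 then t.2 else 0 :=
    Primrec.ite (Primrec.eq.comp (Primrec.nat_mod.comp (Primrec.list_length.comp .fst)
      (.const 2)) (.const 1)) .snd (.const 0)
  have hvalue : OracleComputable fun (τ : Baire) (u : List ℕ) => τ (Encodable.encode u) :=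
    OracleComputable.oracle.comp (.of_primrec Primrec.encode)
  exact (OracleComputable.of_primrec hselect).comp ((OracleComputable.of_primrec .id).pair hvalue)

theorem exists_follows1_oddPart (σ a : Baire) : ∃ x, Follows1 σ x ∧ oddPart x = a := by
  refine ⟨play fun u => if u.length % 2 = 0 then σ (Encodable.encode u) else a (u.length / 2),
    fun n => ?_, funext fun n => ?_⟩
  · rw [play_apply, initSeg_length, if_pos (by omega)]
  · rw [oddPart, play_apply, initSeg_length, if_neg (by omega),
      show (2 * n + 1) / 2 = n by omega]

/-- The position `w` can be reached when Player 2 follows the strategy `τ`. -/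
def ConsistentWith (τ : Baire) (w : List ℕ) : Prop :=
  ∀ i < w.length / 2, zeroExtend w (2 * i + 1) = τ (Encodable.encode (w.take (2 * i + 1)))

theorem Follows2.consistentWith {τ x : Baire} {w : List ℕ} (h : Follows2 τ x)
    (hx : x ∈ cylinder w) : ConsistentWith τ w := by
  intro i hi
  have hw : initSeg x w.length = w := hx
  have hlt : 2 * i + 1 < w.length := by omega
  rw [← mem_cylinder_iff.1 hx _ hlt, h i, ← hw, take_initSeg x hlt.le]

theorem ConsistentWith.exists_follows2 {τ : Baire} {w : List ℕ} (h : ConsistentWith τ w) :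
    ∃ x ∈ cylinder w, Follows2 τ x := by
  obtain ⟨x, hx⟩ : ∃ x : Baire, ∀ i,
      x i = if i < w.length then zeroExtend w i else replyRule τ (initSeg x i) :=
    ⟨play fun u => if u.length < w.length then zeroExtend w u.length else replyRule τ u,
      fun i => by rw [play_apply, initSeg_length]⟩
  have hx_lt (i : ℕ) (hi : i < w.length) : x i = zeroExtend w i := (hx i).trans (if_pos hi)
  have hxw : x ∈ cylinder w := mem_cylinder_iff.2 hx_lt
  have hw : initSeg x w.length = w := hxw
  refine ⟨x, hxw, fun n => ?_⟩
  by_cases hn : 2 * n + 1 < w.length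
  · rw [hx_lt _ hn, h n (by omega), ← take_initSeg x hn.le, hw]
  · rw [hx, if_neg hn, replyRule, initSeg_length, if_pos (by omega)]

theorem follows2_inter_cylinder_nonempty_iff {τ : Baire} {w : List ℕ} :
    ({x | Follows2 τ x} ∩ cylinder w).Nonempty ↔ ConsistentWith τ w :=
  ⟨fun ⟨_, hx, hxw⟩ => Follows2.consistentWith hx hxw,
    fun h => h.exists_follows2.imp fun _ hx => ⟨hx.2, hx.1⟩⟩

theorem primrecMeets_follows2 : PrimrecMeets fun τ => {x | Follows2 τ x} := by
  refine ⟨fun w => Encodable.encode w + 1, fun v w => ConsistentWith (zeroExtend v) w,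
    Primrec.succ.comp Primrec.encode, ?_, fun τ w => ?_⟩
  · have hw : Primrec fun t : ℕ × List ℕ × List ℕ => t.2.2 := .comp .snd .snd
    have hodd : Primrec fun t : ℕ × List ℕ × List ℕ => 2 * t.1 + 1 := primrec_odd.comp .fst
    have hmove : PrimrecRel fun (i : ℕ) (t : List ℕ × List ℕ) => zeroExtend t.2 (2 * i + 1) =
        zeroExtend t.1 (Encodable.encode (t.2.take (2 * i + 1))) :=
      Primrec.eq.comp (primrec_zeroExtend.comp hw hodd) (primrec_zeroExtend.comp
        (Primrec.fst.comp .snd) (Primrec.encode.comp (Primrec.list_take.comp hodd hw)))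
    exact primrecPred_forall_lt hmove
      (Primrec.nat_div.comp (Primrec.list_length.comp .snd) (.const 2))
  · have htake (i : ℕ) : zeroExtend (initSeg τ (Encodable.encode w + 1))
        (Encodable.encode (w.take i)) = τ (Encodable.encode (w.take i)) :=
      zeroExtend_initSeg τ (Nat.lt_succ_of_le (encode_take_le_encode w i))
    simp only [follows2_inter_cylinder_nonempty_iff, ConsistentWith, htake]

theorem primrecMeets_oddPart : PrimrecMeets fun x => {oddPart x} := by
  refine ⟨fun w => 2 * w.length,
    fun v w => ∀ i < w.length, zeroExtend v (2 * i + 1) = zeroExtend w i,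
    Primrec.nat_double.comp Primrec.list_length, ?_, fun x w => ?_⟩
  · have hterm : PrimrecRel fun (i : ℕ) (t : List ℕ × List ℕ) =>
        zeroExtend t.1 (2 * i + 1) = zeroExtend t.2 i :=
      Primrec.eq.comp (primrec_zeroExtend.comp (Primrec.fst.comp .snd) (primrec_odd.comp .fst))
        (primrec_zeroExtend.comp (Primrec.snd.comp .snd) .fst)
    exact primrecPred_forall_lt hterm (Primrec.list_length.comp .snd)
  · rw [Set.singleton_inter_nonempty, mem_cylinder_iff]
    refine forall₂_congr fun i hi => ?_
    have hlt : 2 * i + 1 < 2 * w.length := by omega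
    rw [zeroExtend_initSeg x hlt, oddPart]

/-! ### The two reductions -/

theorem setOf_follows2_inter_nonempty (W : Set Baire) :
    {τ | ({x | Follows2 τ x} ∩ W).Nonempty} = {τ | Wins2 W τ}ᶜ := by
  ext τ
  simp only [Set.Nonempty, Set.mem_inter_iff, Set.mem_ofPred_eq, Set.mem_compl_iff, Wins2,
    not_forall, not_not, exists_prop]

theorem not_wins1_preimage_oddPart {U : Set Baire} {a : Baire} (ha : a ∉ U) (σ : Baire) :
    ¬ Wins1 (oddPart ⁻¹' U) σ := by
  obtain ⟨x, hx, rfl⟩ := exists_follows1_oddPart σ a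
  exact fun hσ => ha (hσ x hx)

theorem findWSPi_strongWeihrauchLE_closedChoice :
    StrongWeihrauchLE FindWSPi (closedChoice baireSpace) := by
  obtain ⟨H, hH, hcode⟩ := primrecMeets_follows2.exists_isOpenCode
  refine .of_oracleComputable OracleComputable.oracle hH fun p W hp hW => ?_
  have hlosing : IsOpenCode (H p) {τ | Wins2 (openSpace.toSet W) τ}ᶜ :=
    setOf_follows2_inter_nonempty _ ▸ hcode p (openSpace.toSet W) hp
  obtain ⟨A, hA, hAW⟩ := hlosing.exists_closedSpace
  have hval : (closedChoice baireSpace).val A = FindWSPi.val W := hAW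
  have hne : ((closedChoice baireSpace).val A).Nonempty := hval ▸ FindWSPi.nonempty W hW
  exact ⟨A, hne, hA, fun q τ hτ hq => ⟨τ, hval.subset hτ, hq⟩⟩

theorem closedChoice_strongWeihrauchLE_findWSPi :
    StrongWeihrauchLE (closedChoice baireSpace) FindWSPi := by
  obtain ⟨H, hH, hcode⟩ := primrecMeets_oddPart.exists_isOpenCode
  refine .of_oracleComputable (oracleComputable_play oracleComputable_replyRule).oddPart hH
    fun p A hp hA => ?_
  have hgame : IsOpenCode (H p) (oddPart ⁻¹' A.1ᶜ) := by
    have hodd := hcode p A.1ᶜ hp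
    simp only [Set.singleton_inter_nonempty] at hodd
    exact hodd
  obtain ⟨W, hW, hWA⟩ := hgame.exists_openSpace
  refine ⟨W, ?_, hW, ?_⟩
  · obtain ⟨a, ha⟩ := hA
    rintro ⟨σ, hσ⟩
    exact not_wins1_preimage_oddPart (not_not.2 ha) σ (hWA ▸ hσ)
  · intro q τ hτ hq
    obtain rfl : q = τ := hq
    have hwins : Wins2 (oddPart ⁻¹' A.1ᶜ) q := hWA ▸ hτ
    exact ⟨_, not_not.1 (hwins _ (follows2_play_replyRule q)), rfl⟩

theorem proposition6_general : StrongWeihrauchEquiv FindWSPi (closedChoice baireSpace) :=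
  ⟨findWSPi_strongWeihrauchLE_closedChoice, closedChoice_strongWeihrauchLE_findWSPi⟩

theorem proposition6 : WeihrauchEquiv FindWSPi (closedChoice baireSpace) :=
  proposition6_general.weihrauchEquiv
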